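/- Let $n>4$ and label the vertices of a convex $n$-gon $P_n$ cyclically by $\mathbb{Z}_n$. Consider triangulations of $P_n$ without extra vertices; the sides of $P_n$ are the external edges, and the diagonals of $P_n$ occurring in a triangulation are its internal edges, or chords (there are $n-3$ of them). A triangulation is *triangle-free* if none of its triangles has three internal edges. A *proper coloring* of a triangle-free triangulation is a bijective labeling of its chords by $0,1,\dots,n-4$ such that the chord labeled $0$ is short, i.e. joins the vertices $i-1$ and $i+1$ for some $i\in\mathbb{Z}_n$, and such that, whenever a triangle of the triangulation has exactly two internal edges, their labels are consecutive integers. Let $CTFT(n)$ be the set of all properly colored triangle-free triangulations of $P_n$. A *flip* of a chord replaces it by the other diagonal of the quadrangle formed by the two triangles adjacent to it; the new chord inherits the label of the flipped chord, and all other chords keep their labels. The *colored flip graph* $\Gamma_n$ has vertex set $CTFT(n)$, and two vertices are adjacent if and only if one is obtained from the other by a flip of a chord. For $T\in CTFT(n)$ let $T^R\in CTFT(n)$ be the same triangulation with reversed coloring: the chord labeled $i$ in $T$ is labeled $n-4-i$ in $T^R$ $(0\le i\le n-4)$. **Theorem (Stanley's conjecture).** For every $n>4$ and every $T\in CTFT(n)$,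 the vertices $T$ and $T^R$ are connected by a path in $\Gamma_n$, and along every shortest path in $\Gamma_n$ from $T$ to $T^R$ each diagonal of $P_n$ is flipped exactly once; that is, for each diagonal $e$ of $P_n$ there is exactly one step of the path whose flip replaces the chord $e$. -/

import Mathlib

namespace Polygon

/-- The vertices of the convex `n`-gon are labelled cyclically by `ZMod n`. An external edge of
the polygon joins two consecutive vertices. -/
def IsExternalEdge {n : ℕ} (e : Sym2 (ZMod n)) : Prop :=
  ∃ i : ZMod n, e = s(i, i + 1)

/-- A diagonal of the polygon joins two distinct vertices which are not consecutive. -/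
def IsDiagonal {n : ℕ} (e : Sym2 (ZMod n)) : Prop :=
  ¬ e.IsDiag ∧ ¬ IsExternalEdge e

/-- A short diagonal joins the two neighbours `i - 1` and `i + 1` of a vertex `i`. -/
def IsShort {n : ℕ} (e : Sym2 (ZMod n)) : Prop :=
  ∃ i : ZMod n, e = s(i - 1, i + 1)

/-- Two diagonals `e` and `f` of a convex polygon cross if the end points of `f` lie strictly on
the two different sides of `e`, that is, in the two different open arcs which the end points of
`e` cut out of the cyclically ordered set of vertices. -/
def Cross {n : ℕ} (e f : Sym2 (ZMod n)) : Prop :=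
  ∃ a b c d : ZMod n, e = s(a, b) ∧ f = s(c, d) ∧ sbtw a c b ∧ sbtw b d a

/-- A triangulation of the convex `n`-gon without extra vertices, given by its set of chords:
a maximal set of pairwise non-crossing diagonals. -/
structure IsTriangulation {n : ℕ} (D : Set (Sym2 (ZMod n))) : Prop where
  isDiagonal : ∀ e ∈ D, IsDiagonal e
  not_cross : ∀ e ∈ D, ∀ f ∈ D, ¬ Cross e f
  maximal : ∀ e, IsDiagonal e → (∀ f ∈ D, ¬ Cross e f) → e ∈ D

/-- `e` is an edge of the triangulation with set of chords `D`: an external edge or a chord. -/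
def IsEdge {n : ℕ} (D : Set (Sym2 (ZMod n))) (e : Sym2 (ZMod n)) : Prop :=
  IsExternalEdge e ∨ e ∈ D

/-- `a`, `b`, `c` are the vertices of a triangle of the triangulation with set of chords `D`.
(There are no vertices in the interior of the polygon, so any three pairwise joined vertices span
a triangle of the triangulation.) -/
structure IsTriangle {n : ℕ} (D : Set (Sym2 (ZMod n))) (a b c : ZMod n) : Prop where
  ne₁ : a ≠ b
  ne₂ : b ≠ c
  ne₃ : a ≠ c
  edge₁ : IsEdge D s(a, b)
  edge₂ : IsEdge D s(b, c)
  edge₃ : IsEdge D s(a, c)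

/-- A triangulation is (internal-)triangle-free if it has no triangle with three internal
edges. -/
def IsTriangleFree {n : ℕ} (D : Set (Sym2 (ZMod n))) : Prop :=
  ∀ a b c : ZMod n, IsTriangle D a b c → ¬ (s(a, b) ∈ D ∧ s(b, c) ∈ D ∧ s(a, c) ∈ D)

/-- The set `CTFT(n)` of properly coloured triangle-free triangulations of the convex `n`-gon.
The colouring is a bijective labelling of the chords by `0, …, n - 4`; it is recorded by the
injective map `chord` which sends each label to the chord that carries it. -/
@[ext]
structure CTFT (n : ℕ) where
  /-- The chord with a given label. -/
  chord : Fin (n - 3) → Sym2 (ZMod n)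
  injective : Function.Injective chord
  isTriangulation : IsTriangulation (Set.range chord)
  isTriangleFree : IsTriangleFree (Set.range chord)
  /-- The chord labelled `0` is short. -/
  isShort_zero : ∀ k : Fin (n - 3), (k : ℕ) = 0 → IsShort (chord k)
  /-- If a triangle has exactly two internal edges, then their labels are consecutive. -/
  consecutive : ∀ (a b c : ZMod n) (i j : Fin (n - 3)),
    IsTriangle (Set.range chord) a b c → chord i = s(a, b) → chord j = s(b, c) →
    s(a, c) ∉ Set.range chord → (i : ℕ) + 1 = j ∨ (j : ℕ) + 1 = i

theorem sbtw_iff_val {n : ℕ} [NeZero n] (a b c : ZMod n) : sbtw a b c ↔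
    a.val < b.val ∧ b.val < c.val ∨ b.val < c.val ∧ c.val < a.val ∨
      c.val < a.val ∧ a.val < b.val := by
  cases n with
  | zero => exact absurd rfl (NeZero.ne 0)
  | succ n => exact Iff.rfl

theorem val_add_one_eq {n : ℕ} (hn : 3 < n) (a : ZMod n) :
    (a + 1).val = a.val + 1 ∨ (a.val + 1 = n ∧ (a + 1).val = 0) := by
  have : NeZero n := ⟨by omega⟩
  have h1 : (1 : ZMod n).val = 1 := ZMod.val_one'' (by omega)
  have h2 := ZMod.val_add a 1
  have h3 := ZMod.val_lt a
  rw [h1] at h2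
  by_cases h : a.val + 1 = n
  · right; rw [h, Nat.mod_self] at h2; exact ⟨h, h2⟩
  · left; rw [h2]; exact Nat.mod_eq_of_lt (by omega)

/-- Every chord `[a, c]` of a triangulation bounds a triangle on the side of the arc from `a` to
`c`. -/
theorem IsTriangulation.exists_apex {n : ℕ} (hn : 3 < n) {D : Set (Sym2 (ZMod n))}
    (hD : IsTriangulation D) {a c : ZMod n} (hac : s(a, c) ∈ D) :
    ∃ b, sbtw a b c ∧ IsEdge D s(a, b) ∧ IsEdge D s(b, c) := by
  classical
  have hn0 : NeZero n := ⟨by omega⟩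
  obtain ⟨hne, hext⟩ := hD.isDiagonal _ hac
  have hne : a ≠ c := by simpa using hne
  have hinj : ∀ x y : ZMod n, x ≠ y → x.val ≠ y.val :=
    fun x y h h' => h (ZMod.val_injective n h')
  let m : ZMod n → ℕ := fun b => if a.val ≤ b.val then b.val - a.val else b.val + n - a.val
  let S : Finset (ZMod n) := Finset.univ.filter fun b => sbtw a b c ∧ IsEdge D s(a, b)
  have hS : S.Nonempty := by
    refine ⟨a + 1, ?_⟩
    simp only [S, Finset.mem_filter, Finset.mem_univ, true_and]
    refine ⟨?_, Or.inl ⟨a, rfl⟩⟩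
    have h1 : a + 1 ≠ c := fun h => hext ⟨a, by rw [h]⟩
    have := hinj _ _ h1
    have := hinj _ _ hne
    have := val_add_one_eq hn a
    have := ZMod.val_lt c
    rw [sbtw_iff_val]
    omega
  obtain ⟨b, hbS, hmax⟩ := Finset.exists_max_image S m hS
  simp only [S, Finset.mem_filter, Finset.mem_univ, true_and] at hbS hmax
  obtain ⟨hb, hab⟩ := hbS
  refine ⟨b, hb, hab, ?_⟩
  by_contra hbc
  have hbc' : b ≠ c := by rintro rfl; exact sbtw_irrefl_right hb
  have hdiag : IsDiagonal s(b, c) := ⟨by simpa using hbc', fun h => hbc (Or.inl h)⟩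
  have hcross : ∃ f ∈ D, Cross s(b, c) f := by
    by_contra h
    push Not at h
    exact hbc (Or.inr (hD.maximal _ hdiag h))
  obtain ⟨f, hf, p, q, r, t, hpq, rfl, h1, h2⟩ := hcross
  have key : ∃ x y, s(x, y) ∈ D ∧ sbtw b x c ∧ sbtw c y b := by
    rcases Sym2.eq_iff.1 hpq with ⟨rfl, rfl⟩ | ⟨rfl, rfl⟩
    · exact ⟨r, t, hf, h1, h2⟩
    · exact ⟨t, r, by rwa [Sym2.eq_swap], h2, h1⟩
  obtain ⟨x, y, hxy, hx, hy⟩ := key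
  have hya : y = a := by
    by_contra hya
    by_cases hyac : sbtw c y a
    · refine hD.not_cross _ hac _ hxy ⟨a, c, x, y, rfl, rfl, ?_, hyac⟩
      rw [sbtw_iff_val] at *
      omega
    · have hyab : sbtw a y b := by
        have := hinj _ _ hya
        rw [sbtw_iff_val] at *
        omega
      rcases hab with ⟨i, hi⟩ | hab
      · have hi1 := val_add_one_eq hn i
        have := ZMod.val_lt y
        have := ZMod.val_lt x
        have := ZMod.val_lt c
        rcases Sym2.eq_iff.1 hi with ⟨rfl, rfl⟩ | ⟨rfl, rfl⟩ <;>
        · rw [sbtw_iff_val] at *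
          omega
      · refine hD.not_cross _ hab _ hxy ⟨b, a, x, y, Sym2.eq_swap, rfl, ?_, hyab⟩
        rw [sbtw_iff_val] at *
        omega
  subst hya
  have hyx : sbtw y x c := by
    rw [sbtw_iff_val] at *
    omega
  have hle := hmax x ⟨hyx, Or.inr (by rwa [Sym2.eq_swap])⟩
  have := ZMod.val_lt x
  have := ZMod.val_lt b
  have := ZMod.val_lt y
  simp only [m] at hle
  rw [sbtw_iff_val] at *
  split_ifs at hle <;> omega

/-- In a properly coloured triangle-free triangulation the chord with the largest label
`n - 4` is short, too. -/
theorem CTFT.isShort_last {n : ℕ} (T : CTFT n) (k : Fin (n - 3)) (hk : (k : ℕ) = n - 4) :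
    IsShort (T.chord k) := by
  have hn : 3 < n := by have := k.isLt; omega
  by_contra hshort
  obtain ⟨a, c, hac⟩ : ∃ a c, T.chord k = s(a, c) := by
    induction h : T.chord k using Sym2.ind with
    | h a c => exact ⟨a, c, rfl⟩
  have hmem : s(a, c) ∈ Set.range T.chord := ⟨k, hac⟩
  have hmem' : s(c, a) ∈ Set.range T.chord := by rwa [Sym2.eq_swap]
  rw [hac] at hshort
  have side : ∀ b, IsTriangle (Set.range T.chord) a b c →
      ∃ j : Fin (n - 3), (j : ℕ) + 1 = k ∧ (T.chord j = s(a, b) ∨ T.chord j = s(b, c)) := by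
    intro b hb
    have htf := T.isTriangleFree a b c hb
    obtain ⟨n1, n2, n3, e1, e2, e3⟩ := hb
    by_cases h1 : s(a, b) ∈ Set.range T.chord
    · have h2 : s(c, b) ∉ Set.range T.chord := by
        rw [Sym2.eq_swap]; exact fun h2 => htf ⟨h1, h2, hmem⟩
      obtain ⟨j, hj⟩ := h1
      have := T.consecutive c a b k j
        ⟨n3.symm, n1, n2.symm, Or.inr hmem', e1, by rwa [Sym2.eq_swap]⟩
        (by rw [hac, Sym2.eq_swap]) hj h2
      exact ⟨j, by have := j.isLt; omega, Or.inl hj⟩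
    · by_cases h2 : s(b, c) ∈ Set.range T.chord
      · obtain ⟨j, hj⟩ := h2
        have := T.consecutive b c a j k
          ⟨n2, n3.symm, n1.symm, e2, Or.inr hmem', by rwa [Sym2.eq_swap]⟩
          hj (by rw [hac, Sym2.eq_swap]) (by rwa [Sym2.eq_swap])
        exact ⟨j, by have := j.isLt; omega, Or.inr hj⟩
      · obtain ⟨i, hi⟩ := e1.resolve_right h1
        obtain ⟨i', hi'⟩ := e2.resolve_right h2
        refine absurd ⟨b, ?_⟩ hshort
        rw [Sym2.eq_iff] at hi hi' ⊢
        grind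
  obtain ⟨b, hb, hb1, hb2⟩ := T.isTriangulation.exists_apex hn hmem
  obtain ⟨d, hd, hd1, hd2⟩ := T.isTriangulation.exists_apex hn hmem'
  have hne : ∀ x y z : ZMod n, sbtw x y z → x ≠ y ∧ y ≠ z ∧ x ≠ z := by
    intro x y z h
    refine ⟨?_, ?_, ?_⟩ <;> rintro rfl
    exacts [sbtw_irrefl_left h, sbtw_irrefl_right h, sbtw_irrefl_left_right h]
  obtain ⟨n1, n2, n3⟩ := hne _ _ _ hb
  obtain ⟨m1, m2, m3⟩ := hne _ _ _ hd
  have hbd : b ≠ d := by rintro rfl; exact sbtw_asymm hb hd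
  obtain ⟨j, hj, hj'⟩ := side b ⟨n1, n2, n3, hb1, hb2, Or.inr hmem⟩
  obtain ⟨l, hl, hl'⟩ := side d ⟨m2.symm, m1.symm, n3, by rwa [Sym2.eq_swap],
    by rwa [Sym2.eq_swap], Or.inr hmem⟩
  obtain rfl : j = l := Fin.ext (by omega)
  rcases hj' with h | h <;> rcases hl' with h' | h' <;> rw [h, Sym2.eq_iff] at h' <;> grind

/-- The triangulation `T^R` with reversed colouring: the chord labelled `i` in `T` is labelled
`n - 4 - i` in `T^R`. -/
def CTFT.reverse {n : ℕ} (T : CTFT n) : CTFT n where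
  chord k := T.chord k.rev
  injective := T.injective.comp Fin.rev_injective
  isTriangulation := by
    have h : Set.range (fun k : Fin (n - 3) => T.chord k.rev) = Set.range T.chord :=
      Fin.rev_surjective.range_comp T.chord
    rw [h]; exact T.isTriangulation
  isTriangleFree := by
    have h : Set.range (fun k : Fin (n - 3) => T.chord k.rev) = Set.range T.chord :=
      Fin.rev_surjective.range_comp T.chord
    rw [h]; exact T.isTriangleFree
  isShort_zero k hk := T.isShort_last _ (by rw [Fin.val_rev]; omega)
  consecutive a b c i j := by
    have h : Set.range (fun k : Fin (n - 3) => T.chord k.rev) = Set.range T.chord :=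
      Fin.rev_surjective.range_comp T.chord
    rw [h]
    intro h1 h2 h3 h4
    have := T.consecutive a b c _ _ h1 h2 h3 h4
    rw [Fin.val_rev, Fin.val_rev] at this
    omega

/-- `S'` is obtained from `S` by a flip of the chord labelled `i`: this chord `[a, c]` is shared
by the two adjacent triangles `a b c` and `a d c` of `S`, and it is replaced by the other
diagonal `[b, d]` of their union, the quadrangle `a b c d`; the new chord inherits the label `i`,
and all other chords keep their labels. -/
def IsFlip {n : ℕ} (i : Fin (n - 3)) (S S' : CTFT n) : Prop :=
  (∃ a b c d : ZMod n, b ≠ d ∧ IsTriangle (Set.range S.chord) a b c ∧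
    IsTriangle (Set.range S.chord) a d c ∧ S.chord i = s(a, c) ∧ S'.chord i = s(b, d)) ∧
  ∀ j, j ≠ i → S'.chord j = S.chord j

theorem IsFlip.symm {n : ℕ} {i : Fin (n - 3)} {S S' : CTFT n} (h : IsFlip i S S') :
    IsFlip i S' S := by
  obtain ⟨⟨a, b, c, d, hbd, h1, h2, hi, hi'⟩, hj⟩ := h
  have key : ∀ e, IsEdge (Set.range S.chord) e → e ≠ s(a, c) →
      IsEdge (Set.range S'.chord) e := by
    rintro e (he | ⟨k, rfl⟩) hne
    · exact Or.inl he
    · have : k ≠ i := by rintro rfl; exact hne hi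
      exact Or.inr ⟨k, hj k this⟩
  have hbd' : IsEdge (Set.range S'.chord) s(b, d) := Or.inr ⟨i, hi'⟩
  obtain ⟨n1, n2, n3, e1, e2, -⟩ := h1
  obtain ⟨m1, m2, -, f1, f2, -⟩ := h2
  refine ⟨⟨b, a, d, c, n3, ⟨n1.symm, m1, hbd, ?_, ?_, hbd'⟩,
    ⟨n2, m2.symm, hbd, ?_, ?_, hbd'⟩, hi', hi⟩, fun j hji => (hj j hji).symm⟩
  · rw [Sym2.eq_swap]; exact key _ e1 (by simp; grind)
  · exact key _ f1 (by simp; grind)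
  · exact key _ e2 (by simp; grind)
  · rw [Sym2.eq_swap]; exact key _ f2 (by simp; grind)

theorem IsFlip.irrefl {n : ℕ} {i : Fin (n - 3)} {S : CTFT n} : ¬ IsFlip i S S := by
  rintro ⟨⟨a, b, c, d, -, h1, h2, hi, hi'⟩, -⟩
  rw [hi] at hi'
  rcases Sym2.eq_iff.1 hi' with ⟨h, -⟩ | ⟨h, -⟩
  · exact h1.ne₁ h
  · exact h2.ne₁ h

/-- The flip graph `Γ_n` on the coloured triangle-free triangulations of the convex `n`-gon. -/
def flipGraph (n : ℕ) : SimpleGraph (CTFT n) where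
  Adj S S' := ∃ i, IsFlip i S S'
  symm := ⟨fun _ _ ⟨i, h⟩ => ⟨i, h.symm⟩⟩
  loopless := ⟨fun _ ⟨_, h⟩ => h.irrefl⟩

/-- The step from `S` to `S'` in the flip graph flips the diagonal `e`: it replaces the chord `e`
of `S`. -/
def FlipsDiagonal {n : ℕ} (S S' : CTFT n) (e : Sym2 (ZMod n)) : Prop :=
  ∃ i, S.chord i = e ∧ IsFlip i S S'

end Polygon

namespace Polygon

variable {n : ℕ}

/-! A properly coloured triangle-free triangulation grows from a short chord by adding one polygon
vertex at a time, on the left or on the right. Its chords are thus nested arcs `[a k, a k + k + 2]`,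
where the integers `a k` stay or drop by one at each step: a staircase, unique up to adding a
multiple of `n` (`CTFT.exists_isLift`, `IsLift.exists_shift`). A flip changes a single entry by one
(`IsFlip.exists_isLift`). Conversely, staircases at l¹-distance `N` are joined by a walk of length
`N` (`exists_walk_of_isLift`).

Replacing each arc by its complement shows that `k ↦ a (n - 4 - k) - 2 - k` lifts the reversal. It
lies at distance `n (n - 3) / 2` from `a`, so a shortest path has at most as many steps as there are
diagonals. On the other hand, lifting an arbitrary path from `T` to its reversal and following its
entries shows that every diagonal is flipped (`exists_flipsDiagonal_of_walk_reverse`). A surjection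
from the steps of a shortest path onto at least as many diagonals is injective, which is the claim.
-/

/-! ### Integer representatives of polygon vertices -/

theorem intCast_inj_of_lt {x y : ℤ} (h₁ : x - y < n) (h₂ : y - x < n) :
    (x : ZMod n) = y ↔ x = y := by
  refine ⟨fun h => ?_, fun h => h ▸ rfl⟩
  rw [ZMod.intCast_eq_intCast_iff_dvd_sub] at h
  have := Int.eq_zero_of_abs_lt_dvd h (by rw [abs_lt]; omega)
  omega

theorem exists_intCast_eq (hn : 0 < n) (w : ℤ) (u : ZMod n) :
    ∃ x : ℤ, w ≤ x ∧ x < w + n ∧ (x : ZMod n) = u := by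
  obtain ⟨y, rfl⟩ := ZMod.intCast_surjective u
  have hn' : (0 : ℤ) < n := by exact_mod_cast hn
  refine ⟨w + (y - w) % n, ?_, ?_, ?_⟩
  · have := Int.emod_nonneg (y - w) hn'.ne'; omega
  · have := Int.emod_lt_of_pos (y - w) hn'; omega
  · push_cast [ZMod.intCast_mod]; ring

/-- The strict cyclic order in terms of representatives in a common window of length `n`. -/
theorem sbtw_intCast_iff (hn : 0 < n) (w : ℤ) {x y z : ℤ} (hx : w ≤ x ∧ x < w + n)
    (hy : w ≤ y ∧ y < w + n) (hz : w ≤ z ∧ z < w + n) :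
    sbtw (x : ZMod n) y z ↔ x < y ∧ y < z ∨ y < z ∧ z < x ∨ z < x ∧ x < y := by
  have : NeZero n := ⟨by omega⟩
  have hn' : (0 : ℤ) < n := by exact_mod_cast hn
  -- Reduction modulo `n` moves the window by a common multiple of `n`, and then the part beyond `n`
  -- by one further `n`; this is a rotation, so it keeps the cyclic order.
  have key : ∀ t : ℤ, w ≤ t ∧ t < w + n →
      (((t : ZMod n).val : ℤ) = t - n * (w / n) ∨ ((t : ZMod n).val : ℤ) = t - n * (w / n) - n) ∧
        ((t : ZMod n).val : ℤ) < n := by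
    intro t ht
    have h1 := Int.emod_add_mul_ediv w n
    have h2 := Int.emod_nonneg w hn'.ne'
    have h3 := Int.emod_lt_of_pos w hn'
    rw [ZMod.val_intCast]
    refine ⟨?_, Int.emod_lt_of_pos t hn'⟩
    have h4 : t % n = (t - n * (w / n)) % n := (Int.sub_mul_emod_self_left ..).symm
    by_cases h : t - n * (w / n) < n
    · left
      rw [h4, Int.emod_eq_of_lt (by omega) h]
    · right
      rw [h4, ← Int.sub_emod_right, Int.emod_eq_of_lt (by omega) (by omega)]
  rw [sbtw_iff_val]
  have kx := key x hx
  have ky := key y hy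
  have kz := key z hz
  generalize (n : ℤ) * (w / n) = q at *
  omega

theorem cross_intCast_iff (hn : 0 < n) (w : ℤ) {x y z t : ℤ} (hx : w ≤ x ∧ x < w + n)
    (hy : w ≤ y ∧ y < w + n) (hz : w ≤ z ∧ z < w + n) (ht : w ≤ t ∧ t < w + n)
    (hxy : x < y) (hzt : z < t) :
    Cross s((x : ZMod n), (y : ZMod n)) s((z : ZMod n), (t : ZMod n)) ↔
      x < z ∧ z < y ∧ y < t ∨ z < x ∧ x < t ∧ t < y := by
  constructor
  · rintro ⟨a, b, c, d, h1, h2, h3, h4⟩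
    rcases Sym2.eq_iff.1 h1 with ⟨rfl, rfl⟩ | ⟨rfl, rfl⟩ <;>
    rcases Sym2.eq_iff.1 h2 with ⟨rfl, rfl⟩ | ⟨rfl, rfl⟩ <;>
    · rw [sbtw_intCast_iff hn w (by assumption) (by assumption) (by assumption)] at h3 h4
      omega
  · rintro (h | h)
    · refine ⟨_, _, _, _, rfl, rfl, ?_, ?_⟩ <;>
      rw [sbtw_intCast_iff hn w (by assumption) (by assumption) (by assumption)] <;> omega
    · refine ⟨_, _, _, _, rfl, Sym2.eq_swap, ?_, ?_⟩ <;>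
      rw [sbtw_intCast_iff hn w (by assumption) (by assumption) (by assumption)] <;> omega

theorem isExternalEdge_intCast_iff (hn : 2 < n) (w : ℤ) {x y : ℤ} (hx : w ≤ x ∧ x < w + n)
    (hy : w ≤ y ∧ y < w + n) :
    IsExternalEdge s((x : ZMod n), (y : ZMod n)) ↔
      y = x + 1 ∨ x = y + 1 ∨ y = x + n - 1 ∨ x = y + n - 1 := by
  have key : ∀ {x y : ℤ}, w ≤ x ∧ x < w + n → w ≤ y ∧ y < w + n →
      ((y : ZMod n) = (x : ZMod n) + 1 ↔ y = x + 1 ∨ x = y + n - 1) := by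
    intro x y hx hy
    by_cases h : y = w
    · have h1 : (y : ZMod n) = ((y + n : ℤ) : ZMod n) := by simp
      have h2 : (x : ZMod n) + 1 = ((x + 1 : ℤ) : ZMod n) := by simp
      rw [h1, h2, intCast_inj_of_lt] <;> omega
    · have h2 : (x : ZMod n) + 1 = ((x + 1 : ℤ) : ZMod n) := by simp
      rw [h2, intCast_inj_of_lt] <;> omega
  have : IsExternalEdge s((x : ZMod n), (y : ZMod n)) ↔
      (y : ZMod n) = (x : ZMod n) + 1 ∨ (x : ZMod n) = (y : ZMod n) + 1 := by
    constructor
    · rintro ⟨i, h⟩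
      rcases Sym2.eq_iff.1 h with ⟨rfl, h⟩ | ⟨h, rfl⟩
      · exact Or.inl h
      · exact Or.inr h
    · rintro (h | h)
      · exact ⟨_, by rw [h]⟩
      · exact ⟨y, by rw [h, Sym2.eq_swap]⟩
  rw [this, key hx hy, key hy hx]
  omega

/-! ### Staircases and the triangulations they define -/

/-- Integer sequences which stay constant or drop by one at each of the first `m` steps. -/
def IsStaircase (m : ℕ) (a : ℕ → ℤ) : Prop :=
  ∀ k < m, a (k + 1) = a k ∨ a (k + 1) = a k - 1

/-- Left ends decrease and right ends increase weakly: the arcs are nested. In particular all lie in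
the largest one, which misses only the vertex `a (n - 4) - 1`; hence the window used below. -/
theorem IsStaircase.bounds {m : ℕ} {a : ℕ → ℤ} (ha : IsStaircase m a) {j k : ℕ} (hjk : j ≤ k)
    (hk : k ≤ m) : a k ≤ a j ∧ a j + j ≤ a k + k := by
  induction k, hjk using Nat.le_induction with
  | base => simp
  | succ k hjk ih =>
    have := ih (by omega)
    have := ha k (by omega)
    push_cast
    omega

/-- The arc of length `k + 2` starting at `a k`, seen as a chord. -/
def arcChord (n : ℕ) (a : ℕ → ℤ) (k : ℕ) : Sym2 (ZMod n) :=
  s((a k : ZMod n), ((a k + k + 2 : ℤ) : ZMod n))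

/-- In the window starting at `a (n - 4) - 1`, an arc is determined by its end points. -/
theorem arcChord_eq_iff (hn : 4 < n) {a : ℕ → ℤ} (ha : IsStaircase (n - 4) a) {k : ℕ}
    (hk : k ≤ n - 4) {x y : ℤ} (hx : a (n - 4) - 1 ≤ x ∧ x < a (n - 4) - 1 + n)
    (hy : a (n - 4) - 1 ≤ y ∧ y < a (n - 4) - 1 + n) :
    arcChord n a k = s((x : ZMod n), (y : ZMod n)) ↔
      a k = x ∧ a k + k + 2 = y ∨ a k = y ∧ a k + k + 2 = x := by
  have := ha.bounds hk le_rfl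
  rw [arcChord, Sym2.eq_iff, intCast_inj_of_lt, intCast_inj_of_lt, intCast_inj_of_lt,
    intCast_inj_of_lt] <;> omega

theorem isTriangulation_arcChord (hn : 4 < n) {a : ℕ → ℤ} (ha : IsStaircase (n - 4) a) :
    IsTriangulation (Set.range fun k : Fin (n - 3) => arcChord n a k) where
  isDiagonal := by
    rintro _ ⟨k, rfl⟩
    have := k.isLt
    have h := ha.bounds (show (k : ℕ) ≤ n - 4 by omega) le_rfl
    constructor
    · simp only [arcChord, Sym2.mk_isDiag_iff]
      rw [intCast_inj_of_lt] <;> omega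
    · simp only [arcChord]
      rw [isExternalEdge_intCast_iff (by omega) (a (n - 4) - 1)] <;> omega
  not_cross := by
    rintro _ ⟨j, rfl⟩ _ ⟨k, rfl⟩
    have := k.isLt
    have := j.isLt
    have hk := ha.bounds (show (k : ℕ) ≤ n - 4 by omega) le_rfl
    have hj := ha.bounds (show (j : ℕ) ≤ n - 4 by omega) le_rfl
    simp only [arcChord]
    rw [cross_intCast_iff (by omega) (a (n - 4) - 1)]
    · rcases le_total (j : ℕ) k with h | h
      · have := ha.bounds h (by omega); omega
      · have := ha.bounds h (by omega); omega
    all_goals omega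
  maximal := by
    intro e
    induction e using Sym2.ind with | h u v => ?_
    have hn0 : 0 < n := by omega
    obtain ⟨x, hx, hx', rfl⟩ := exists_intCast_eq hn0 (a (n - 4) - 1) u
    obtain ⟨y, hy, hy', rfl⟩ := exists_intCast_eq hn0 (a (n - 4) - 1) v
    wlog hxy : x < y generalizing x y
    · rcases (not_lt.1 hxy).eq_or_lt with h | h
      · subst h
        intro h
        exact absurd rfl h.1
      · have := this y hy hy' x hx hx' h
        rwa [Sym2.eq_swap] at this
    rintro ⟨-, hext⟩ hcross
    rw [isExternalEdge_intCast_iff (by omega) (a (n - 4) - 1) ⟨hx, hx'⟩ ⟨hy, hy'⟩] at hext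
    have hcr : ∀ k ≤ n - 4, ¬ (x < a k ∧ a k < y ∧ y < a k + k + 2 ∨
        a k < x ∧ x < a k + k + 2 ∧ a k + k + 2 < y) := by
      intro k hk
      have hb := ha.bounds hk le_rfl
      have := hcross _ ⟨⟨k, by omega⟩, rfl⟩
      simp only [arcChord] at this
      rwa [cross_intCast_iff hn0 (a (n - 4) - 1)] at this
      all_goals omega
    suffices ∃ k ≤ n - 4, a k = x ∧ a k + k + 2 = y by
      obtain ⟨k, hk, h1, h2⟩ := this
      exact ⟨⟨k, by omega⟩, by simp only [arcChord]; rw [h1, ← h2, h1]⟩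
    by_contra hne
    push Not at hne
    -- Going down from the largest arc, a diagonal that crosses no arc and equals none is squeezed
    -- into each smaller one, finally into an arc of length two, where no other diagonal fits.
    have key : ∀ j k, k + j = n - 4 → a k ≤ x ∧ y ≤ a k + k + 2 := by
      intro j
      induction j with
      | zero =>
        intro k hk
        obtain rfl : k = n - 4 := hk
        have := hcr _ le_rfl
        omega
      | succ j ih =>
        intro k hk
        have h1 := ih (k + 1) (by omega)
        have h2 := hcr k (by omega)
        have h3 := hne (k + 1) (by omega)
        have h4 := ha k (by omega)
        push_cast at h1 h3
        omega
    have h1 := key (n - 4) 0 (by omega)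
    have h2 := hne 0 (by omega)
    push_cast at h1 h2
    omega

/-- Three chords on ordered representatives `x < y < z` would include the arcs `[x, y]` and `[y,
z]`, which are not nested. -/
theorem isTriangleFree_arcChord (hn : 4 < n) {a : ℕ → ℤ} (ha : IsStaircase (n - 4) a) :
    IsTriangleFree (Set.range fun k : Fin (n - 3) => arcChord n a k) := by
  intro u v t _
  have hn0 : 0 < n := by omega
  obtain ⟨x, hx, hx', rfl⟩ := exists_intCast_eq hn0 (a (n - 4) - 1) u
  obtain ⟨y, hy, hy', rfl⟩ := exists_intCast_eq hn0 (a (n - 4) - 1) v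
  obtain ⟨z, hz, hz', rfl⟩ := exists_intCast_eq hn0 (a (n - 4) - 1) t
  rintro ⟨⟨i, hi⟩, ⟨j, hj⟩, ⟨k, hk⟩⟩
  have hi0 : (i : ℕ) ≤ n - 4 := by omega
  have hj0 : (j : ℕ) ≤ n - 4 := by omega
  have hk0 : (k : ℕ) ≤ n - 4 := by omega
  have hi := (arcChord_eq_iff hn ha hi0 ⟨hx, hx'⟩ ⟨hy, hy'⟩).1 hi
  have hj := (arcChord_eq_iff hn ha hj0 ⟨hy, hy'⟩ ⟨hz, hz'⟩).1 hj
  have hk := (arcChord_eq_iff hn ha hk0 ⟨hx, hx'⟩ ⟨hz, hz'⟩).1 hk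
  have hb := fun (p q : ℕ) (h : p ≤ n - 4) (h' : q ≤ n - 4) (hpq : p ≤ q) => ha.bounds hpq h'
  have h1 := hb _ _ hi0 hj0
  have h2 := hb _ _ hj0 hi0
  have h3 := hb _ _ hi0 hk0
  have h4 := hb _ _ hk0 hi0
  have h5 := hb _ _ hj0 hk0
  have h6 := hb _ _ hk0 hj0
  omega

theorem injective_arcChord (hn : 4 < n) {a : ℕ → ℤ} (ha : IsStaircase (n - 4) a) :
    Function.Injective fun k : Fin (n - 3) => arcChord n a k := by
  intro j k h
  have hj := ha.bounds (show (j : ℕ) ≤ n - 4 by omega) le_rfl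
  have hk := ha.bounds (show (k : ℕ) ≤ n - 4 by omega) le_rfl
  have h := (arcChord_eq_iff hn ha (by omega) (by omega) (by omega)).1 h
  ext
  omega

theorem consecutive_arcChord (hn : 4 < n) {a : ℕ → ℤ} (ha : IsStaircase (n - 4) a)
    {u v t : ZMod n} {i j : Fin (n - 3)} (hut : u ≠ t) (he : IsExternalEdge s(u, t))
    (hi : arcChord n a i = s(u, v)) (hj : arcChord n a j = s(v, t)) :
    (i : ℕ) + 1 = j ∨ (j : ℕ) + 1 = i := by
  have hn0 : 0 < n := by omega
  obtain ⟨x, hx, hx', rfl⟩ := exists_intCast_eq hn0 (a (n - 4) - 1) u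
  obtain ⟨y, hy, hy', rfl⟩ := exists_intCast_eq hn0 (a (n - 4) - 1) v
  obtain ⟨z, hz, hz', rfl⟩ := exists_intCast_eq hn0 (a (n - 4) - 1) t
  have hi0 : (i : ℕ) ≤ n - 4 := by omega
  have hj0 : (j : ℕ) ≤ n - 4 := by omega
  have hi := (arcChord_eq_iff hn ha hi0 ⟨hx, hx'⟩ ⟨hy, hy'⟩).1 hi
  have hj := (arcChord_eq_iff hn ha hj0 ⟨hy, hy'⟩ ⟨hz, hz'⟩).1 hj
  rw [isExternalEdge_intCast_iff (by omega) (a (n - 4) - 1) ⟨hx, hx'⟩ ⟨hz, hz'⟩] at he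
  have h1 := ha.bounds hi0 le_rfl
  have h2 := ha.bounds hj0 le_rfl
  have h3 := fun h : (i : ℕ) ≤ j => ha.bounds h hj0
  have h4 := fun h : (j : ℕ) ≤ i => ha.bounds h hi0
  omega

/-- The properly coloured triangle-free triangulation whose chords are the arcs starting at the
entries of a staircase. -/
def ofStaircase (hn : 4 < n) (a : ℕ → ℤ) (ha : IsStaircase (n - 4) a) : CTFT n where
  chord k := arcChord n a k
  injective := injective_arcChord hn ha
  isTriangulation := isTriangulation_arcChord hn ha
  isTriangleFree := isTriangleFree_arcChord hn ha
  isShort_zero k hk := ⟨(a k : ZMod n) + 1, Sym2.eq_iff.2 (Or.inl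
    ⟨by ring, by push_cast [hk]; ring⟩)⟩
  consecutive _ _ _ _ _ h hi hj hac :=
    consecutive_arcChord hn ha h.ne₃ (h.edge₃.resolve_right hac) hi hj

/-! ### Every coloured triangulation comes from a staircase -/

/-- The staircase `a` lifts `T` if the chords of `T` are the arcs starting at the entries
of `a`. -/
structure IsLift (T : CTFT n) (a : ℕ → ℤ) : Prop where
  isStaircase : IsStaircase (n - 4) a
  chord_eq : ∀ k : Fin (n - 3), T.chord k = arcChord n a k

theorem arcChord_congr {a b : ℕ → ℤ} {k : ℕ} (h : (a k : ZMod n) = b k) :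
    arcChord n a k = arcChord n b k := by
  simp [arcChord, h]

/-- Consider the triangle on the outer side of chord `k`. Its other two sides are not both external
since `k < n - 4`, nor both internal, so exactly one is a chord, with label `k - 1` or `k + 1`. The
chord `k - 1` lies inside the arc, which leaves `k + 1`; the external side says at which end the arc
grows. -/
theorem CTFT.chord_succ (hn : 4 < n) (T : CTFT n) {k : ℕ} (hk : k < n - 4) {a : ℕ → ℤ}
    (ha : IsStaircase k a)
    (h : ∀ j : Fin (n - 3), (j : ℕ) ≤ k → T.chord j = arcChord n a j) :
    ∃ v : ℤ, (v = a k ∨ v = a k - 1) ∧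
      T.chord ⟨k + 1, by omega⟩ = s((v : ZMod n), ((v + (k + 1 : ℕ) + 2 : ℤ) : ZMod n)) := by
  have hn0 : 0 < n := by omega
  have hk1 : k + 1 < n - 3 := by omega
  set x := a k with hx
  obtain ⟨y, hy⟩ : ∃ y, y = x + k + 2 := ⟨_, rfl⟩
  have hchord : T.chord ⟨k, by omega⟩ = s((x : ZMod n), (y : ZMod n)) := by
    subst hy
    exact h _ le_rfl
  have hmem : s((x : ZMod n), (y : ZMod n)) ∈ Set.range T.chord := ⟨_, hchord⟩
  have hmem' : s((y : ZMod n), (x : ZMod n)) ∈ Set.range T.chord := by rwa [Sym2.eq_swap]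
  obtain ⟨d, hd, hd1, hd2⟩ := T.isTriangulation.exists_apex (by omega) hmem'
  obtain ⟨z, hz, hz', rfl⟩ := exists_intCast_eq hn0 x d
  rw [sbtw_intCast_iff hn0 x (by omega) (by omega) (by omega)] at hd
  have ne1 : (x : ZMod n) ≠ y := by rw [Ne, intCast_inj_of_lt] <;> omega
  have ne2 : (y : ZMod n) ≠ z := by rw [Ne, intCast_inj_of_lt] <;> omega
  have ne3 : (x : ZMod n) ≠ z := by rw [Ne, intCast_inj_of_lt] <;> omega
  have hd2' : IsEdge (Set.range T.chord) s((x : ZMod n), (z : ZMod n)) := by rwa [Sym2.eq_swap]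
  have htri : IsTriangle (Set.range T.chord) (x : ZMod n) y z :=
    ⟨ne1, ne2, ne3, Or.inr hmem, hd1, hd2'⟩
  have htri' : IsTriangle (Set.range T.chord) (y : ZMod n) x z :=
    ⟨ne1.symm, ne3, ne2, Or.inr hmem', hd2', hd1⟩
  have htf := T.isTriangleFree _ _ _ htri
  have hext1 := isExternalEdge_intCast_iff (n := n) (by omega) x (x := y) (y := z)
    (by omega) (by omega)
  have hext2 := isExternalEdge_intCast_iff (n := n) (by omega) x (x := x) (y := z)
    (by omega) (by omega)
  have hnot : ∀ (j : Fin (n - 3)) (t : ℤ), x ≤ t ∧ t ≤ y →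
      T.chord j = s((t : ZMod n), (z : ZMod n)) → (j : ℕ) + 1 ≠ k := by
    intro j t ht hj hjk
    have hb := ha.bounds (j := j) (k := k) (by omega) le_rfl
    rw [h j (by omega), arcChord, Sym2.eq_iff] at hj
    rcases hj with ⟨-, hj⟩ | ⟨hj, -⟩ <;> rw [intCast_inj_of_lt] at hj <;> omega
  by_cases h1 : s((y : ZMod n), (z : ZMod n)) ∈ Set.range T.chord
  · have h2 : s((x : ZMod n), (z : ZMod n)) ∉ Set.range T.chord := fun h2 => htf ⟨hmem, h1, h2⟩
    obtain ⟨j, hj⟩ := h1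
    have hcons := T.consecutive _ _ _ _ j htri hchord hj h2
    have := hnot j y (by omega) hj
    have hz1 := hext2.1 (hd2'.resolve_right h2)
    obtain rfl : ⟨k + 1, hk1⟩ = j := Fin.ext (by simp only at hcons ⊢; omega)
    refine ⟨x - 1, Or.inr rfl, ?_⟩
    obtain rfl : z = x - 1 + n := by omega
    rw [hj, Sym2.eq_swap, show x - 1 + (k + 1 : ℕ) + 2 = y by push_cast; omega]
    simp
  · have hz1 := hext1.1 (hd1.resolve_right h1)
    by_cases h2 : s((x : ZMod n), (z : ZMod n)) ∈ Set.range T.chord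
    · obtain ⟨j, hj⟩ := h2
      have hcons := T.consecutive _ _ _ _ j htri' (hchord.trans Sym2.eq_swap) hj h1
      have := hnot j x (by omega) hj
      obtain rfl : ⟨k + 1, hk1⟩ = j := Fin.ext (by simp only at hcons ⊢; omega)
      refine ⟨x, Or.inl rfl, ?_⟩
      rw [hj, show x + (k + 1 : ℕ) + 2 = z by push_cast; omega]
    · have hz2 := hext2.1 (hd2'.resolve_right h2)
      omega

theorem CTFT.exists_isLift (hn : 4 < n) (T : CTFT n) : ∃ a, IsLift T a := by
  suffices ∀ k ≤ n - 4, ∃ a : ℕ → ℤ, IsStaircase k a ∧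
      ∀ j : Fin (n - 3), (j : ℕ) ≤ k → T.chord j = arcChord n a j by
    obtain ⟨a, ha, h⟩ := this (n - 4) le_rfl
    exact ⟨a, ha, fun k => h k (by omega)⟩
  intro k
  induction k with
  | zero =>
    intro _
    have h0 : 0 < n - 3 := by omega
    obtain ⟨i, hi⟩ := T.isShort_zero ⟨0, h0⟩ rfl
    obtain ⟨x, rfl⟩ := ZMod.intCast_surjective i
    refine ⟨fun _ => x - 1, fun k hk => absurd hk k.not_lt_zero, fun j hj => ?_⟩
    obtain rfl : ⟨0, h0⟩ = j := Fin.ext (by simp only; omega)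
    rw [hi]
    refine Sym2.eq_iff.2 (Or.inl ⟨by push_cast; ring, by push_cast; ring⟩)
  | succ k ih =>
    intro hk
    have hk1 : k + 1 < n - 3 := by omega
    obtain ⟨a, ha, h⟩ := ih (by omega)
    obtain ⟨v, hv, hchord⟩ := T.chord_succ hn hk ha h
    refine ⟨Function.update a (k + 1) v, fun j hj => ?_, fun j hj => ?_⟩
    · rcases (Nat.lt_succ_iff.1 hj).eq_or_lt with rfl | hj
      · simpa using hv
      · rw [Function.update_of_ne (by omega), Function.update_of_ne (by omega)]
        exact ha j hj
    · rcases hj.eq_or_lt with hj | hj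
      · obtain rfl : ⟨k + 1, hk1⟩ = j := Fin.ext hj.symm
        rw [hchord]
        simp [arcChord]
      · rw [h j (by omega)]
        exact arcChord_congr (by rw [Function.update_of_ne (by omega)])

theorem isLift_ofStaircase (hn : 4 < n) {a : ℕ → ℤ} (ha : IsStaircase (n - 4) a) :
    IsLift (ofStaircase hn a ha) a :=
  ⟨ha, fun _ => rfl⟩

/-! ### Uniqueness of lifts up to multiples of `n` -/

theorem IsStaircase.add_const {m : ℕ} {a : ℕ → ℤ} (ha : IsStaircase m a) (c : ℤ) :
    IsStaircase m fun k => a k + c := by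
  intro k hk
  have := ha k hk
  simp only
  omega

theorem IsLift.add_mul {T : CTFT n} {a : ℕ → ℤ} (ha : IsLift T a) (s : ℤ) :
    IsLift T fun k => a k + n * s :=
  ⟨ha.isStaircase.add_const _, fun k => (ha.chord_eq k).trans (arcChord_congr (by simp))⟩

theorem eq_zero_or_eq_of_dvd {x : ℤ} (h : (n : ℤ) ∣ x) (h₁ : -n < x) (h₂ : x < 2 * n) :
    x = 0 ∨ x = n := by
  by_cases hx : x < n
  · exact Or.inl (Int.eq_zero_of_abs_lt_dvd h (abs_lt.2 ⟨h₁, hx⟩))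
  · have := Int.eq_zero_of_abs_lt_dvd (h.sub dvd_rfl) (abs_lt.2 ⟨by omega, by omega⟩)
    omega

/-- Two staircases which agree somewhere have the same entries wherever their arcs agree. -/
theorem IsStaircase.eq_of_arcChord_eq (hn : 4 < n) {a b : ℕ → ℤ} (ha : IsStaircase (n - 4) a)
    (hb : IsStaircase (n - 4) b) {i j : ℕ} (hi : i = 0 ∨ i = n - 4) (hj : j ≤ n - 4)
    (hij : a i = b i) (h : arcChord n a j = arcChord n b j) : a j = b j := by
  have h1 : i ≤ j → a j ≤ a i ∧ a i + i ≤ a j + j := fun hij => ha.bounds hij hj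
  have h2 : j ≤ i → a i ≤ a j ∧ a j + j ≤ a i + i := fun hij => ha.bounds hij (by omega)
  have h3 : i ≤ j → b j ≤ b i ∧ b i + i ≤ b j + j := fun hij => hb.bounds hij hj
  have h4 : j ≤ i → b i ≤ b j ∧ b j + j ≤ b i + i := fun hij => hb.bounds hij (by omega)
  rw [arcChord, arcChord, Sym2.eq_iff] at h
  rcases h with ⟨h, -⟩ | ⟨h, h'⟩
  · rwa [intCast_inj_of_lt] at h <;> omega
  -- Complementary arcs would both be half the polygon, with `n = 2 * j + 4` and starts `j + 2`
  -- apart; agreement at an extreme label keeps the starts within `j`.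
  · rw [eq_comm, ZMod.intCast_eq_intCast_iff_dvd_sub] at h'
    rw [ZMod.intCast_eq_intCast_iff_dvd_sub] at h
    have h5 := eq_zero_or_eq_of_dvd h (by omega) (by omega)
    have h6 := eq_zero_or_eq_of_dvd h' (by omega) (by omega)
    omega

/-- Arcs with an extreme label have length `2` or `n - 2`. These differ as `n > 4`, so the chord
determines where the arc starts modulo `n`. -/
theorem exists_shift_of_arcChord_eq (hn : 4 < n) {a b : ℕ → ℤ} {i : ℕ} (hi : i = 0 ∨ i = n - 4)
    (h : arcChord n a i = arcChord n b i) : ∃ s : ℤ, a i = b i + n * s := by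
  have hn0 : 0 < n := by omega
  rw [arcChord, arcChord, Sym2.eq_iff] at h
  rcases h with ⟨h, -⟩ | ⟨h1, h2⟩
  · rw [eq_comm, ZMod.intCast_eq_intCast_iff_dvd_sub] at h
    obtain ⟨s, hs⟩ := h
    exact ⟨s, by omega⟩
  · rw [ZMod.intCast_eq_intCast_iff_dvd_sub] at h1
    rw [eq_comm, ZMod.intCast_eq_intCast_iff_dvd_sub] at h2
    have h3 := eq_zero_or_eq_of_dvd (dvd_add h1 h2) (by omega) (by omega)
    omega

/-! ### Flips as unit changes of one entry -/

theorem IsFlip.chord_ne {i : Fin (n - 3)} {S S' : CTFT n} (h : IsFlip i S S') :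
    S'.chord i ≠ S.chord i := by
  intro he
  obtain rfl : S' = S := by
    refine CTFT.ext (funext fun j => ?_)
    by_cases hj : j = i
    · rw [hj, he]
    · exact h.2 j hj
  exact h.irrefl

theorem IsFlip.label_unique {i j : Fin (n - 3)} {S S' : CTFT n} (h : IsFlip i S S')
    (h' : IsFlip j S S') : i = j := by
  by_contra hij
  exact h.chord_ne (h'.2 i hij)

/-- A flip changes the staircase by one in a single entry. -/
theorem IsFlip.exists_isLift (hn : 4 < n) {i : Fin (n - 3)} {S S' : CTFT n} (h : IsFlip i S S')
    {a : ℕ → ℤ} (ha : IsLift S a) : ∃ b, IsLift S' b ∧ (∀ j ≤ n - 4, j ≠ i → b j = a j) ∧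
      (b i = a i + 1 ∨ b i = a i - 1) := by
  obtain ⟨c, hc⟩ := S'.exists_isLift hn
  have hoff : ∀ j ≤ n - 4, j ≠ i → arcChord n c j = arcChord n a j := by
    intro j hj hji
    have := h.2 ⟨j, by omega⟩ (fun h => hji (congrArg Fin.val h))
    rwa [hc.chord_eq, ha.chord_eq] at this
  -- An extreme label that is not flipped anchors the lift of `S'` to `a`.
  obtain ⟨p, hp, hpi⟩ : ∃ p, (p = 0 ∨ p = n - 4) ∧ p ≠ i := by
    by_cases hi : (i : ℕ) = 0
    · exact ⟨n - 4, Or.inr rfl, by omega⟩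
    · exact ⟨0, Or.inl rfl, Ne.symm hi⟩
  obtain ⟨s, hs⟩ := exists_shift_of_arcChord_eq hn hp (hoff p (by omega) hpi)
  have hb := hc.add_mul (-s)
  obtain ⟨b, hbdef⟩ : ∃ b : ℕ → ℤ, b = fun k => c k + n * -s := ⟨_, rfl⟩
  rw [← hbdef] at hb
  have hbp : b p = a p := by rw [hbdef]; simp only [hs]; ring
  have hbj : ∀ j ≤ n - 4, j ≠ i → b j = a j := by
    intro j hj hji
    refine hb.isStaircase.eq_of_arcChord_eq hn ha.isStaircase hp hj hbp ?_
    have h1 := hb.chord_eq ⟨j, by omega⟩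
    rw [hc.chord_eq] at h1
    rw [← h1]
    exact hoff j hj hji
  have hbi : b i ≠ a i := by
    intro hbi
    apply h.chord_ne
    rw [hb.chord_eq, ha.chord_eq]
    exact arcChord_congr (by rw [hbi])
  refine ⟨b, hb, hbj, ?_⟩
  -- An unflipped neighbouring entry leaves only two values, one apart, for entry `i`.
  obtain ⟨i, hi⟩ := i
  simp only at hbj hbi ⊢
  cases i with
  | zero =>
    have h1 := hbj 1 (by omega) (by omega)
    have h2 := ha.isStaircase 0 (by omega)
    have h3 := hb.isStaircase 0 (by omega)
    simp only [zero_add] at h2 h3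
    omega
  | succ i =>
    have h1 := hbj i (by omega) (by omega)
    have h2 := ha.isStaircase i (by omega)
    have h3 := hb.isStaircase i (by omega)
    omega

/-- With `[x, y]` the arc of label `i`, both sequences being staircases forces the neighbouring arcs
to be `[x, y - 1]` and `[x - 1, y]`, external edges at the extreme labels. The flip takes place in
the quadrangle `x - 1, x, y - 1, y`. -/
theorem isFlip_of_isLift (hn : 4 < n) {S S' : CTFT n} {a b : ℕ → ℤ} (ha : IsLift S a)
    (hb : IsLift S' b) (i : Fin (n - 3)) (hab : ∀ j ≤ n - 4, j ≠ i → b j = a j)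
    (hi : b i = a i - 1) : IsFlip i S S' := by
  have hi' := i.isLt
  obtain ⟨x, hx⟩ : ∃ x, x = a i := ⟨_, rfl⟩
  obtain ⟨y, hy⟩ : ∃ y, y = a i + i + 2 := ⟨_, rfl⟩
  have hchord : S.chord i = s((x : ZMod n), (y : ZMod n)) := by
    rw [ha.chord_eq, arcChord, hx, hy]
  have hinner : IsEdge (Set.range S.chord) s((x : ZMod n), ((y - 1 : ℤ) : ZMod n)) := by
    by_cases h0 : (i : ℕ) = 0
    · refine Or.inl ⟨(x : ZMod n), ?_⟩
      rw [show y - 1 = x + 1 by omega]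
      simp
    · right
      refine ⟨⟨i - 1, by omega⟩, ?_⟩
      have h1 := ha.isStaircase (i - 1) (by omega)
      have h2 := hb.isStaircase (i - 1) (by omega)
      have h3 := hab (i - 1) (by omega) (by omega)
      rw [Nat.sub_add_cancel (by omega)] at h1 h2
      rw [ha.chord_eq, arcChord]
      simp only
      rw [show a (i - 1) = x by omega, show x + (i - 1 : ℕ) + 2 = y - 1 by omega]
  have houter : IsEdge (Set.range S.chord) s(((x - 1 : ℤ) : ZMod n), (y : ZMod n)) := by
    by_cases h0 : (i : ℕ) = n - 4
    · refine Or.inl ⟨(y : ZMod n), ?_⟩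
      rw [Sym2.eq_swap, show x - 1 = y + 1 - n by omega]
      simp
    · right
      refine ⟨⟨i + 1, by omega⟩, ?_⟩
      have h1 := ha.isStaircase i (by omega)
      have h2 := hb.isStaircase i (by omega)
      have h3 := hab (i + 1) (by omega) (by omega)
      rw [ha.chord_eq, arcChord]
      simp only
      rw [show a (i + 1) = x - 1 by omega, show x - 1 + (i + 1 : ℕ) + 2 = y by push_cast; omega]
  have hmem : s((x : ZMod n), (y : ZMod n)) ∈ Set.range S.chord := ⟨i, hchord⟩
  have hxx : IsExternalEdge s((x : ZMod n), ((x - 1 : ℤ) : ZMod n)) :=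
    ⟨((x - 1 : ℤ) : ZMod n), by rw [Sym2.eq_swap]; simp⟩
  have hyy : IsExternalEdge s(((y - 1 : ℤ) : ZMod n), (y : ZMod n)) :=
    ⟨((y - 1 : ℤ) : ZMod n), by simp⟩
  refine ⟨⟨x, (x - 1 : ℤ), y, (y - 1 : ℤ), ?_, ⟨?_, ?_, ?_, Or.inl hxx, houter, Or.inr hmem⟩,
    ⟨?_, ?_, ?_, hinner, Or.inl hyy, Or.inr hmem⟩, hchord, ?_⟩, fun j hj => ?_⟩
  iterate 7 (rw [Ne, intCast_inj_of_lt] <;> omega)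
  · rw [hb.chord_eq, arcChord, hi, ← hx, show x - 1 + i + 2 = y - 1 by omega]
  · rw [ha.chord_eq, hb.chord_eq]
    exact arcChord_congr (by rw [hab j (by omega) (fun h => hj (Fin.ext h))])

/-! ### Walks as short as the l¹-distance -/

theorem IsStaircase.exists_descent {m : ℕ} {a b : ℕ → ℤ} (ha : IsStaircase m a)
    (hb : IsStaircase m b) (h : ∃ k ≤ m, b k < a k) :
    ∃ i ≤ m, b i < a i ∧ IsStaircase m (Function.update a i (a i - 1)) := by
  obtain ⟨k, hk, hlt⟩ := h
  -- Up to a constant, `2 * a k + k` is the sum of the ends of arc `k`; it rises by one where `a`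
  -- stays and falls by one where `a` drops. A neighbour that obstructs lowering `a i` would also
  -- lie above `b` and have a larger value.
  obtain ⟨i, hi, hmax⟩ := ((Finset.range (m + 1)).filter fun k => b k < a k).exists_max_image
    (fun k => 2 * a k + k) ⟨k, by simp; omega⟩
  simp only [Finset.mem_filter, Finset.mem_range] at hi hmax
  refine ⟨i, by omega, hi.2, fun j hj => ?_⟩
  have h1 := ha j hj
  have h2 := hb j hj
  have h3 := hmax j
  have h4 := hmax (j + 1)
  push_cast at h4
  by_cases hji : j = i
  · subst hji
    rw [Function.update_self, Function.update_of_ne (by omega)]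
    omega
  · by_cases hji' : j + 1 = i
    · subst hji'
      rw [Function.update_self, Function.update_of_ne (by omega)]
      push_cast at h3
      omega
    · rwa [Function.update_of_ne hji', Function.update_of_ne hji]

/-- The number of unit changes which separate two staircases. -/
def staircaseDist (n : ℕ) (a b : ℕ → ℤ) : ℕ :=
  ∑ k ∈ Finset.range (n - 3), (a k - b k).natAbs

theorem staircaseDist_comm (a b : ℕ → ℤ) : staircaseDist n a b = staircaseDist n b a :=
  Finset.sum_congr rfl fun _ _ => by omega

theorem staircaseDist_update {a b : ℕ → ℤ} {i : ℕ} (hi : i < n - 3) (h : b i < a i) :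
    staircaseDist n (Function.update a i (a i - 1)) b + 1 = staircaseDist n a b := by
  have : ∀ k ∈ Finset.range (n - 3), (a k - b k).natAbs =
      (Function.update a i (a i - 1) k - b k).natAbs + if i = k then 1 else 0 := by
    intro k _
    by_cases hk : i = k
    · subst hk
      simp only [Function.update_self, if_true]
      omega
    · rw [Function.update_of_ne (Ne.symm hk), if_neg hk, add_zero]
  rw [staircaseDist, staircaseDist, Finset.sum_congr rfl this, Finset.sum_add_distrib,
    Finset.sum_ite_eq, if_pos (Finset.mem_range.2 hi)]

theorem IsLift.exists_adj (hn : 4 < n) {S : CTFT n} {a b : ℕ → ℤ} (ha : IsLift S a)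
    (hb : IsStaircase (n - 4) b) (h : ∃ k ≤ n - 4, b k < a k) :
    ∃ S₁ a₁, IsLift S₁ a₁ ∧ (flipGraph n).Adj S S₁ ∧
      staircaseDist n a₁ b + 1 = staircaseDist n a b := by
  obtain ⟨i, hi, hlt, hst⟩ := ha.isStaircase.exists_descent hb h
  refine ⟨_, _, isLift_ofStaircase hn hst, ⟨⟨i, by omega⟩, ?_⟩,
    staircaseDist_update (by omega) hlt⟩
  exact isFlip_of_isLift hn ha (isLift_ofStaircase hn hst) _
    (fun j _ hji => Function.update_of_ne hji _ _) (Function.update_self ..)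

theorem exists_walk_of_isLift (hn : 4 < n) {N : ℕ} {S S' : CTFT n} {a b : ℕ → ℤ}
    (ha : IsLift S a) (hb : IsLift S' b) (hN : staircaseDist n a b = N) :
    ∃ p : (flipGraph n).Walk S S', p.length = N := by
  induction N generalizing S S' a b with
  | zero =>
    obtain rfl : S = S' := by
      refine CTFT.ext (funext fun k => ?_)
      have := Finset.sum_eq_zero_iff.1 hN k (by simp)
      rw [ha.chord_eq, hb.chord_eq]
      exact arcChord_congr (by rw [show a k = b k by omega])
    exact ⟨.nil, rfl⟩
  | succ N ih =>
    obtain ⟨k, hk, hne⟩ : ∃ k ≤ n - 4, a k ≠ b k := by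
      by_contra! h
      have : staircaseDist n a b = 0 := Finset.sum_eq_zero fun k hk => by
        have := h k (by rw [Finset.mem_range] at hk; omega)
        omega
      omega
    -- Only descents are available, so where `a` is below `b` the far end descends and the edge is
    -- traversed backwards.
    rcases lt_or_gt_of_ne hne with hlt | hlt
    · obtain ⟨S₁, b₁, hb₁, hadj, hd⟩ := hb.exists_adj hn ha.isStaircase ⟨k, hk, hlt⟩
      obtain ⟨p, hp⟩ := ih ha hb₁
        (by rw [staircaseDist_comm a b] at hN; rw [staircaseDist_comm]; omega)
      exact ⟨p.concat hadj.symm, by rw [SimpleGraph.Walk.length_concat, hp]⟩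
    · obtain ⟨S₁, a₁, ha₁, hadj, hd⟩ := ha.exists_adj hn hb.isStaircase ⟨k, hk, hlt⟩
      obtain ⟨p, hp⟩ := ih ha₁ hb (by omega)
      exact ⟨.cons hadj p, by rw [SimpleGraph.Walk.length_cons, hp]⟩

/-! ### Lifted walks and the diagonals they flip -/

/-- A walk in the flip graph lifts to a sequence of staircases. -/
theorem exists_lift_walk (hn : 4 < n) {S S' : CTFT n} (p : (flipGraph n).Walk S S')
    {a : ℕ → ℤ} (ha : IsLift S a) : ∃ A : ℕ → ℕ → ℤ, A 0 = a ∧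
      (∀ t ≤ p.length, IsLift (p.getVert t) (A t)) ∧
      ∀ t < p.length, ∃ i : Fin (n - 3), IsFlip i (p.getVert t) (p.getVert (t + 1)) ∧
        (∀ j ≤ n - 4, j ≠ i → A (t + 1) j = A t j) ∧
        (A (t + 1) i = A t i + 1 ∨ A (t + 1) i = A t i - 1) := by
  induction p generalizing a with
  | nil => exact ⟨fun _ => a, rfl, fun _ _ => ha, fun t ht => absurd ht t.not_lt_zero⟩
  | cons hadj p ih =>
    obtain ⟨i, hi⟩ := id hadj
    obtain ⟨b, hb, hbj, hbi⟩ := hi.exists_isLift hn ha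
    obtain ⟨A, hA0, hA, hstep⟩ := ih hb
    refine ⟨fun t => Nat.casesOn t a A, rfl, fun t ht => ?_, fun t ht => ?_⟩
    · cases t with
      | zero => exact ha
      | succ t =>
        rw [SimpleGraph.Walk.getVert_cons_succ]
        exact hA t (by simpa using ht)
    · cases t with
      | zero =>
        refine ⟨i, ?_, ?_⟩
        · rw [SimpleGraph.Walk.getVert_cons_succ, SimpleGraph.Walk.getVert_zero,
            SimpleGraph.Walk.getVert_zero]
          exact hi
        · simp only [hA0]
          exact ⟨hbj, hbi⟩
      | succ t =>
        rw [SimpleGraph.Walk.getVert_cons_succ, SimpleGraph.Walk.getVert_cons_succ]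
        exact hstep t (by simpa using ht)

theorem exists_drop {u : ℕ → ℤ} {L : ℕ} {x : ℤ} (h0 : x ≤ u 0) (hL : u L < x) :
    ∃ t < L, x ≤ u t ∧ u (t + 1) < x := by
  by_contra! h
  have : ∀ t ≤ L, x ≤ u t := by
    intro t
    induction t with
    | zero => exact fun _ => h0
    | succ t ih => exact fun ht => h t ht (ih (by omega))
  exact absurd (this L le_rfl) (not_le.2 hL)

/-- A discrete intermediate value theorem: unit steps cannot jump over `x`, so the step that passes
it starts at `x`. -/
theorem exists_leave {u : ℕ → ℤ} {L : ℕ} {x : ℤ} (hu : ∀ t < L, |u (t + 1) - u t| ≤ 1)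
    (h : x ≤ u 0 ∧ u L < x ∨ u 0 ≤ x ∧ x < u L) : ∃ t < L, u t = x ∧ u (t + 1) ≠ u t := by
  rcases h with ⟨h1, h2⟩ | ⟨h1, h2⟩
  · obtain ⟨t, ht, h3, h4⟩ := exists_drop h1 h2
    have := abs_le.1 (hu t ht)
    exact ⟨t, ht, by omega, by omega⟩
  · obtain ⟨t, ht, h3, h4⟩ := exists_drop (u := fun t => -u t) (x := -x) (L := L)
      (by simpa using h1) (by simpa using h2)
    have := abs_le.1 (hu t ht)
    exact ⟨t, ht, by omega, by omega⟩

/-- If the staircase entry `a k` has to move past `x` along a walk, then the arc of length `k + 2`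
starting at `x` is flipped. -/
theorem exists_flipsDiagonal (hn : 4 < n) {S S' : CTFT n} {p : (flipGraph n).Walk S S'}
    {A : ℕ → ℕ → ℤ} (hA : ∀ t ≤ p.length, IsLift (p.getVert t) (A t))
    (hstep : ∀ t < p.length, ∃ i : Fin (n - 3), IsFlip i (p.getVert t) (p.getVert (t + 1)) ∧
        (∀ j ≤ n - 4, j ≠ i → A (t + 1) j = A t j) ∧
        (A (t + 1) i = A t i + 1 ∨ A (t + 1) i = A t i - 1))
    {k : ℕ} (hk : k ≤ n - 4) {x y : ℤ} (hy : y = x + k + 2)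
    (h : x ≤ A 0 k ∧ A p.length k < x ∨ A 0 k ≤ x ∧ x < A p.length k) :
    ∃ t < p.length,
      FlipsDiagonal (p.getVert t) (p.getVert (t + 1)) s((x : ZMod n), (y : ZMod n)) := by
  obtain ⟨t, ht, hx, hne⟩ := exists_leave (u := fun t => A t k) (fun t ht => by
    obtain ⟨i, -, h1, h2⟩ := hstep t ht
    rw [abs_le]
    by_cases hki : k = i
    · subst hki; omega
    · have := h1 k hk hki; omega) h
  obtain ⟨i, hi, h1, -⟩ := hstep t ht
  obtain rfl : k = i := by
    by_contra hki
    exact hne (h1 k hk hki)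
  refine ⟨t, ht, i, ?_, hi⟩
  rw [(hA t ht.le).chord_eq, arcChord]
  rw [hx, ← hy]

/-- The window for `x` may depend on the arc length, so that it can be placed next to the initial
entry `k` of a walk. -/
theorem exists_arc_of_isDiagonal (hn : 4 < n) {e : Sym2 (ZMod n)} (he : IsDiagonal e) (c : ℕ → ℤ) :
    ∃ k ≤ n - 4, ∃ x : ℤ, c k ≤ x ∧ x < c k + n ∧
      e = s((x : ZMod n), ((x + k + 2 : ℤ) : ZMod n)) := by
  induction e using Sym2.ind with | h u v => ?_
  have hn0 : 0 < n := by omega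
  obtain ⟨x, -, -, rfl⟩ := exists_intCast_eq hn0 0 u
  obtain ⟨y, hy, hy', rfl⟩ := exists_intCast_eq hn0 x v
  obtain ⟨h1, h2⟩ := he
  rw [Sym2.mk_isDiag_iff, intCast_inj_of_lt (by omega) (by omega)] at h1
  rw [isExternalEdge_intCast_iff (by omega) x (by omega) (by omega)] at h2
  obtain ⟨k, hk⟩ : ∃ k : ℕ, y = x + k + 2 := ⟨(y - x - 2).toNat, by omega⟩
  obtain ⟨z, hz, hz', hzx⟩ := exists_intCast_eq hn0 (c k) (x : ZMod n)
  refine ⟨k, by omega, z, hz, hz', ?_⟩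
  rw [hk]
  push_cast
  rw [hzx]

/-! ### Reversal -/

theorem IsLift.exists_shift (hn : 4 < n) {S : CTFT n} {a b : ℕ → ℤ} (ha : IsLift S a)
    (hb : IsLift S b) : ∃ s : ℤ, ∀ k ≤ n - 4, a k = b k + n * s := by
  have h : ∀ k ≤ n - 4, arcChord n a k = arcChord n b k := fun k hk => by
    rw [← ha.chord_eq ⟨k, by omega⟩, ← hb.chord_eq ⟨k, by omega⟩]
  obtain ⟨s, hs⟩ := exists_shift_of_arcChord_eq hn (Or.inl rfl) (h 0 (by omega))
  have hb' := hb.add_mul s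
  refine ⟨s, fun k hk => ha.isStaircase.eq_of_arcChord_eq hn hb'.isStaircase (Or.inl rfl) hk hs ?_⟩
  rw [h k hk, ← hb.chord_eq ⟨k, by omega⟩, ← hb'.chord_eq ⟨k, by omega⟩]

/-- The complement of the arc with label `n - 4 - k` has length `k + 2` and starts at the right end
`a (n - 4 - k) - 2 - k + n`. -/
theorem IsLift.reverse (hn : 4 < n) {T : CTFT n} {a : ℕ → ℤ} (ha : IsLift T a) :
    IsLift T.reverse fun k => a (n - 4 - k) - 2 - k where
  isStaircase k hk := by
    have := ha.isStaircase (n - 4 - (k + 1)) (by omega)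
    rw [show n - 4 - (k + 1) + 1 = n - 4 - k by omega] at this
    push_cast
    omega
  chord_eq k := by
    change T.chord k.rev = _
    have h : ((k.rev : Fin (n - 3)) : ℕ) = n - 4 - k := by rw [Fin.val_rev]; omega
    rw [ha.chord_eq, h, arcChord, arcChord, Sym2.eq_swap]
    rw [show a (n - 4 - k) + (n - 4 - k : ℕ) + 2 = a (n - 4 - k) - 2 - k + n by omega,
      show a (n - 4 - k) - 2 - k + k + 2 = a (n - 4 - k) by omega]
    simp

/-- By nestedness the differences at `k` and `n - 4 - k` are both nonnegative, and they add up to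
`n`. -/
theorem two_mul_staircaseDist_reverse (hn : 4 < n) {a : ℕ → ℤ} (ha : IsStaircase (n - 4) a) :
    2 * staircaseDist n a (fun k => a (n - 4 - k) - 2 - k) = n * (n - 3) := by
  have h := Finset.sum_range_reflect
    (fun k => (a k - (a (n - 4 - k) - 2 - (k : ℤ))).natAbs) (n - 3)
  rw [two_mul, staircaseDist]
  nth_rw 1 [← h]
  rw [← Finset.sum_add_distrib, mul_comm n, ← smul_eq_mul]
  refine (Finset.sum_congr rfl fun k hk => ?_).trans ((Finset.sum_const n).trans (by simp))
  rw [Finset.mem_range] at hk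
  rw [show n - 3 - 1 - k = n - 4 - k by omega, show n - 4 - (n - 4 - k) = k by omega]
  rcases le_total k (n - 4 - k) with hle | hle
  · have := ha.bounds hle (by omega)
    omega
  · have := ha.bounds hle (by omega)
    omega

/-- Every walk from `T` to its reversal flips every diagonal. -/
theorem exists_flipsDiagonal_of_walk_reverse (hn : 4 < n) {T : CTFT n}
    (p : (flipGraph n).Walk T T.reverse) {e : Sym2 (ZMod n)} (he : IsDiagonal e) :
    ∃ t < p.length, FlipsDiagonal (p.getVert t) (p.getVert (t + 1)) e := by
  obtain ⟨a, ha⟩ := T.exists_isLift hn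
  obtain ⟨A, rfl, hA, hstep⟩ := exists_lift_walk hn p ha
  have hL := hA p.length le_rfl
  rw [SimpleGraph.Walk.getVert_length] at hL
  obtain ⟨s, hs⟩ := hL.exists_shift hn (ha.reverse hn)
  -- The final staircase is the reversed one shifted by `n * s`: all entries end lower if `s ≤ 0`
  -- and higher if `s ≥ 1`.
  rcases le_or_gt s 0 with hs0 | hs0
  · have hns : (n : ℤ) * s ≤ 0 := mul_nonpos_of_nonneg_of_nonpos (by omega) hs0
    obtain ⟨k, hk, x, hx, hx', rfl⟩ := exists_arc_of_isDiagonal hn he fun k => A 0 k - n + 1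
    have h1 := hs k hk
    have h2 := hs (n - 4 - k) (by omega)
    rw [show n - 4 - (n - 4 - k) = k by omega] at h2
    -- If entry `k` does not pass `x`, the reversal formula makes entry `n - 4 - k` start at or
    -- above `x + k + 2`, and `x > A 0 k - n` makes it end below: the complementary arc of the same
    -- diagonal is flipped.
    by_cases h : A p.length k < x
    · exact exists_flipsDiagonal hn hA hstep hk rfl (Or.inl ⟨by omega, h⟩)
    · have := exists_flipsDiagonal hn hA hstep (show n - 4 - k ≤ n - 4 by omega)
        (x := x + k + 2) (y := x + n) (by omega) (Or.inl (by omega))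
      rw [Sym2.eq_swap]
      simpa using this
  · have hns : (n : ℤ) * 1 ≤ n * s := mul_le_mul_of_nonneg_left (by omega) (by omega)
    obtain ⟨k, hk, x, hx, hx', rfl⟩ := exists_arc_of_isDiagonal hn he fun k => A 0 k
    have h1 := hs k hk
    have h2 := hs (n - 4 - k) (by omega)
    rw [show n - 4 - (n - 4 - k) = k by omega] at h2
    by_cases h : x < A p.length k
    · exact exists_flipsDiagonal hn hA hstep hk rfl (Or.inr ⟨by omega, h⟩)
    · have := exists_flipsDiagonal hn hA hstep (show n - 4 - k ≤ n - 4 by omega)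
        (x := x + k + 2 - n) (y := x) (by omega) (Or.inr (by omega))
      rw [Sym2.eq_swap]
      simpa using this

/-! ### Counting diagonals and conclusion -/

open Classical in
-- Only this inequality is needed, so it suffices that there are at most `n` external edges among
-- the `n.choose 2` pairs.
theorem mul_le_two_mul_card_isDiagonal [NeZero n] :
    n * (n - 3) ≤ 2 * (Finset.univ.filter fun e : Sym2 (ZMod n) => IsDiagonal e).card := by
  have h1 : (Finset.univ.filter fun e : Sym2 (ZMod n) => ¬ e.IsDiag).card = n.choose 2 := by
    rw [← Fintype.card_subtype, Sym2.card_subtype_not_diag, ZMod.card]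
  have h2 : (Finset.univ.image fun i : ZMod n => s(i, i + 1)).card ≤ n :=
    Finset.card_image_le.trans (by simp [ZMod.card])
  have h3 : (Finset.univ.filter fun e : Sym2 (ZMod n) => ¬ e.IsDiag) ⊆
      (Finset.univ.filter fun e : Sym2 (ZMod n) => IsDiagonal e) ∪
        Finset.univ.image fun i : ZMod n => s(i, i + 1) := by
    intro e he
    by_cases hext : IsExternalEdge e
    · obtain ⟨i, rfl⟩ := hext
      simp
    · exact Finset.mem_union_left _ (by simpa using ⟨by simpa using he, hext⟩)
  have h4 := (Finset.card_le_card h3).trans (Finset.card_union_le _ _)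
  have h5 : 2 * n.choose 2 = n * (n - 1) := by
    rw [Nat.choose_two_right, Nat.mul_div_cancel' (Nat.even_mul_pred_self n).two_dvd]
  have h6 : n * (n - 3) = n * (n - 1) - n * 2 := by rw [← Nat.mul_sub]; rfl
  omega

end Polygon

open Polygon in
theorem mainTheorem1 (n : ℕ) (hn : 4 < n) (T : Polygon.CTFT n) :
    (Polygon.flipGraph n).Reachable T T.reverse ∧
    ∀ p : (Polygon.flipGraph n).Walk T T.reverse,
      p.length = (Polygon.flipGraph n).dist T T.reverse →
      ∀ e : Sym2 (ZMod n), Polygon.IsDiagonal e →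
        ∃! k : ℕ, k < p.length ∧
          Polygon.FlipsDiagonal (p.getVert k) (p.getVert (k + 1)) e := by
  classical
  have : NeZero n := ⟨by omega⟩
  obtain ⟨a, ha⟩ := T.exists_isLift hn
  obtain ⟨q, hq⟩ := exists_walk_of_isLift hn ha (ha.reverse hn) rfl
  refine ⟨⟨q⟩, fun p hp e he => ?_⟩
  have hlen : 2 * p.length ≤ n * (n - 3) := by
    rw [← two_mul_staircaseDist_reverse hn ha.isStaircase, ← hq, hp]
    exact Nat.mul_le_mul_left 2 (SimpleGraph.dist_le q)
  have hflip : ∀ t : Fin p.length, ∃ i, IsFlip i (p.getVert t) (p.getVert (t + 1)) :=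
    fun t => p.adj_getVert_succ t.isLt
  choose i hi using hflip
  have hiff : ∀ (t : Fin p.length) e, FlipsDiagonal (p.getVert t) (p.getVert (t + 1)) e ↔
      (p.getVert t).chord (i t) = e := by
    refine fun t e => ⟨?_, fun h => ⟨i t, h, hi t⟩⟩
    rintro ⟨j, hj, hj'⟩
    rwa [(hi t).label_unique hj']
  -- The flipped chords exhaust the diagonals, and by `hlen` there are no more steps than diagonals.
  have hinj : Set.InjOn (fun t : Fin p.length => (p.getVert t).chord (i t))
      (Finset.univ : Finset (Fin p.length)) := by
    refine Finset.injOn_of_surjOn_of_card_le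
      (t := Finset.univ.filter fun e : Sym2 (ZMod n) => IsDiagonal e) _ ?_ ?_ ?_
    · intro t _
      simpa using (p.getVert t).isTriangulation.isDiagonal _ ⟨i t, rfl⟩
    · intro e he
      obtain ⟨t, ht, h⟩ := exists_flipsDiagonal_of_walk_reverse hn p (by simpa using he)
      exact ⟨⟨t, ht⟩, by simp, (hiff ⟨t, ht⟩ e).1 h⟩
    · have := mul_le_two_mul_card_isDiagonal (n := n)
      simp only [Finset.card_univ, Fintype.card_fin]
      omega
  obtain ⟨t, ht, h⟩ := exists_flipsDiagonal_of_walk_reverse hn p he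
  refine ⟨t, ⟨ht, h⟩, ?_⟩
  rintro t' ⟨ht', h'⟩
  exact congrArg Fin.val (hinj (x₁ := ⟨t', ht'⟩) (x₂ := ⟨t, ht⟩) (by simp) (by simp)
    (((hiff ⟨t', ht'⟩ e).1 h').trans ((hiff ⟨t, ht⟩ e).1 h).symm))
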